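/- Let $q$ be a prime power, let $\sigma_1$ be the map on $\mathbb F_{q^2}[x]$ that raises every coefficient to the $q$-th power, and for a polynomial $f$ over a field with $f(0)\neq 0$ let $f^*(x)=f(0)^{-1}x^{\deg f}f(1/x)$ be its monic reciprocal. A monic irreducible polynomial $f\in\mathbb F_{q^2}[x]$, $f\ne x$, is called SCRIM (self-conjugate-reciprocal irreducible monic) if $f^*=\sigma_1(f)$; a monic irreducible polynomial $G\in\mathbb F_q[x]$, $G\neq x$, is called self-reciprocal if $G^*=G$. Let $n\ge 3$ be an odd integer. Then a monic irreducible polynomial $f\in\mathbb F_{q^2}[x]$ of degree $n$ is SCRIM if and only if $f$ divides, in $\mathbb F_{q^2}[x]$, a self-reciprocal irreducible monic polynomial $G\in\mathbb F_q[x]$ of degree $2n$. Moreover, the number of SCRIM polynomials of degree $n$ in $\mathbb F_{q^2}[x]$ equals $$\frac1n\sum_{d\mid n}\mu(d)\,q^{n/d},$$ where $\mu$ is the Möbius function. -/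

import Mathlib

open Polynomial

/-- The monic reciprocal `f* = f(0)⁻¹ · x ^ deg f · f(1/x)` of a polynomial with `f(0) ≠ 0`. -/
noncomputable def monicReciprocal {K : Type*} [Field K] (f : K[X]) : K[X] :=
  C (f.coeff 0)⁻¹ * f.reverse

/-- The conjugate `σ₁(f)` of `f ∈ K[x]` over the finite field `F`: the `q`-th power map,
`q = #F`, is applied to every coefficient. -/
noncomputable def conjugatePoly (F : Type*) {K : Type*} [Field F] [Fintype F] [Field K]
    [Algebra F K] (f : K[X]) : K[X] :=
  f.map (FiniteField.frobeniusAlgHom F K : K →+* K)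

/-- Self-reciprocal irreducible monic (SRIM) polynomials (distinct from `x`, so that `f(0) ≠ 0`
and the monic reciprocal makes sense). -/
structure IsSRIM {F : Type*} [Field F] (f : F[X]) : Prop where
  monic : f.Monic
  irreducible : Irreducible f
  ne_X : f ≠ X
  reciprocal_eq : monicReciprocal f = f

/-- Self-conjugate-reciprocal irreducible monic (SCRIM) polynomials over an extension `K` of the
finite field `F` (used for the quadratic extension). -/
structure IsSCRIM (F : Type*) {K : Type*} [Field F] [Fintype F] [Field K] [Algebra F K]
    (f : K[X]) : Prop where
  monic : f.Monic
  irreducible : Irreducible f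
  ne_X : f ≠ X
  reciprocal_eq : monicReciprocal f = conjugatePoly F f

/-! Take a root `α` of `f` in an algebraic closure. Then `f*` and `σ₁(f)` are the minimal
polynomials of `α⁻¹` and `α ^ q`, so `f` is SCRIM iff `α⁻¹ = α ^ q ^ (2 * i + 1)` for some `i`.
Since `n` is odd, this collapses to `α ^ (q ^ n + 1) = 1` (`isSCRIM_minpoly_iff_pow_eq_one`). The
same equation characterises SRIM polynomials of degree `2n` over `F`
(`isSRIM_minpoly_iff_pow_eq_one`), and for `n > 1` it forces that degree
(`natDegree_minpoly_base_of_pow_eq_one`).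

For the count, sort the `q ^ m + 1` solutions of `α ^ (q ^ m + 1) = 1`, `m` odd, by their degree
over `K`, apply Möbius inversion, and divide by the `n` roots of each polynomial. -/

theorem pow_pow_add_mul {M : Type*} [Monoid M] {α : M} {q d : ℕ} (h : α ^ q ^ d = α) (i j : ℕ) :
    α ^ q ^ (i + d * j) = α ^ q ^ i := by
  induction j with
  | zero => simp
  | succ j ih =>
    rw [show i + d * (j + 1) = d + (i + d * j) by ring, pow_add, pow_mul, h, ih]

/-! ### Frobenius orbits and minimal polynomials -/

section FrobeniusOrbits

variable {K L : Type*} [Field K] [Finite K] [Field L] [Algebra K L]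

theorem pow_card_pow_injective (i : ℕ) :
    Function.Injective fun x : L => x ^ Nat.card K ^ i := by
  have := Fintype.ofFinite K
  have h := ((FiniteField.frobeniusAlgHom K L : L →+* L) ^ i).injective
  have e : ⇑((FiniteField.frobeniusAlgHom K L : L →+* L) ^ i) =
      fun x : L => x ^ Nat.card K ^ i := by
    ext x
    rw [RingHom.coe_pow, RingHom.coe_coe, FiniteField.coe_frobeniusAlgHom, pow_iterate,
      Nat.card_eq_fintype_card]
  rwa [e] at h

theorem minpoly_pow_card_pow (α : L) (i : ℕ) :
    minpoly K (α ^ Nat.card K ^ i) = minpoly K α := by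
  have := Fintype.ofFinite K
  have h := minpoly.algHom_eq (FiniteField.frobeniusAlgHom K L ^ i)
    ((FiniteField.frobeniusAlgHom K L ^ i).injective) α
  rw [← h]
  rw [AlgHom.coe_pow, FiniteField.coe_frobeniusAlgHom, pow_iterate, Nat.card_eq_fintype_card]

variable [Algebra.IsAlgebraic K L]

theorem pow_card_pow_eq_self_iff (α : L) (k : ℕ) :
    α ^ Nat.card K ^ k = α ↔ (minpoly K α).natDegree ∣ k := by
  have hα : IsIntegral K α := Algebra.IsIntegral.isIntegral α
  rw [(minpoly.irreducible hα).natDegree_dvd_iff_dvd_X_pow_card_pow_sub_X,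
    minpoly.dvd_iff]
  simp [sub_eq_zero]

/-- The degree is the least period under Frobenius, so it depends only on which iterates fix the
element. -/
theorem natDegree_minpoly_eq_of_pow_iff {α β : L}
    (h : ∀ k, α ^ Nat.card K ^ k = α ↔ β ^ Nat.card K ^ k = β) :
    (minpoly K α).natDegree = (minpoly K β).natDegree := by
  simp only [pow_card_pow_eq_self_iff] at h
  exact Nat.dvd_antisymm ((h _).2 dvd_rfl) ((h _).1 dvd_rfl)

theorem natDegree_minpoly_inv (α : L) :
    (minpoly K α⁻¹).natDegree = (minpoly K α).natDegree :=
  natDegree_minpoly_eq_of_pow_iff fun k => by rw [inv_pow, inv_inj]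

theorem natDegree_minpoly_of_injective {α : L} {m : ℕ}
    (h : Function.Injective fun x : L => x ^ m) :
    (minpoly K (α ^ m)).natDegree = (minpoly K α).natDegree :=
  natDegree_minpoly_eq_of_pow_iff fun k => by
    rw [pow_right_comm]; exact h.eq_iff

/-- The first `d` Frobenius iterates of `α` are distinct roots of a polynomial of degree `d`, so
they exhaust its roots. -/
theorem exists_eq_pow_card_pow_of_minpoly_eq {α β : L} (h : minpoly K α = minpoly K β) :
    ∃ i, β = α ^ Nat.card K ^ i := by
  classical
  have hα : IsIntegral K α := Algebra.IsIntegral.isIntegral α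
  have h0 : minpoly K α ≠ 0 := minpoly.ne_zero hα
  set d := (minpoly K α).natDegree with hd
  set R := ((minpoly K α).aroots L).toFinset with hR
  set S := (Finset.range d).image fun i => α ^ Nat.card K ^ i with hS
  have hmem (γ : L) : γ ∈ R ↔ aeval γ (minpoly K α) = 0 := by
    simp [hR, h0]
  have hSR : S ⊆ R := by
    intro γ hγ
    obtain ⟨i, -, rfl⟩ := Finset.mem_image.1 hγ
    rw [hmem, ← minpoly_pow_card_pow α i]
    exact minpoly.aeval _ _
  have hinj : Set.InjOn (fun i => α ^ Nat.card K ^ i) (Finset.range d : Set ℕ) := by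
    have key : ∀ i j, i ≤ j → j < d → α ^ Nat.card K ^ i = α ^ Nat.card K ^ j → i = j := by
      intro i j hij hj e
      obtain ⟨k, rfl⟩ := Nat.exists_eq_add_of_le hij
      rw [add_comm i k, pow_add, pow_mul] at e
      have := (pow_card_pow_eq_self_iff (K := K) α k).1 (pow_card_pow_injective (K := K) i e).symm
      have := Nat.eq_zero_of_dvd_of_lt this (by omega)
      omega
    intro i hi j hj e
    simp only [Finset.coe_range, Set.mem_Iio] at hi hj
    rcases le_total i j with hij | hij
    · exact key i j hij hj e
    · exact (key j i hij hi e.symm).symm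
  have hcard : R.card ≤ S.card := by
    rw [hS, Finset.card_image_of_injOn hinj, Finset.card_range]
    refine (Multiset.toFinset_card_le _).trans ((card_roots' _).trans ?_)
    rw [natDegree_map]
  have hβ : β ∈ S := by
    rw [Finset.eq_of_subset_of_card_le hSR hcard, hmem, h]
    exact minpoly.aeval _ _
  obtain ⟨i, -, rfl⟩ := Finset.mem_image.1 hβ
  exact ⟨i, rfl⟩

end FrobeniusOrbits

/-! ### Reciprocals and conjugates of minimal polynomials -/

section Reciprocal

variable {K L : Type*} [Field K] [Field L] [Algebra K L]

theorem eq_minpoly_of_monic_of_natDegree_le {f : K[X]} {α : L} (hα : IsIntegral K α)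
    (hf : f.Monic) (h : aeval α f = 0) (hd : f.natDegree ≤ (minpoly K α).natDegree) :
    f = minpoly K α :=
  eq_of_monic_of_dvd_of_natDegree_le (minpoly.monic hα) hf (minpoly.dvd K α h) hd

theorem monicReciprocal_minpoly [Finite K] [Algebra.IsAlgebraic K L] {α : L} (h0 : α ≠ 0) :
    monicReciprocal (minpoly K α) = minpoly K α⁻¹ := by
  have hα : IsIntegral K α := Algebra.IsIntegral.isIntegral α
  have hc : (minpoly K α).coeff 0 ≠ 0 := fun h => h0 ((minpoly.coeff_zero_eq_zero hα).1 h)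
  apply eq_minpoly_of_monic_of_natDegree_le (Algebra.IsIntegral.isIntegral _)
  · rw [monicReciprocal, Monic, leadingCoeff_mul, leadingCoeff_C, reverse_leadingCoeff,
      trailingCoeff_eq_coeff_zero hc, inv_mul_cancel₀ hc]
  · have := invertibleOfNonzero h0
    have := (eval₂_reverse_eq_zero_iff (algebraMap K L) α (minpoly K α)).2 (minpoly.aeval K α)
    rw [invOf_eq_inv] at this
    rw [monicReciprocal, map_mul, aeval_def (α⁻¹) (minpoly K α).reverse, this, mul_zero]
  · rw [natDegree_minpoly_inv, monicReciprocal, natDegree_C_mul (inv_ne_zero hc)]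
    exact reverse_natDegree_le _

theorem conjugatePoly_minpoly (F : Type*) [Field F] [Fintype F] [Algebra F K] [Algebra F L]
    [Finite K] [Algebra.IsAlgebraic K L] (α : L) :
    conjugatePoly F (minpoly K α) = minpoly K (α ^ Fintype.card F) := by
  have hinj := pow_card_pow_injective (K := F) (L := L) 1
  rw [pow_one, Nat.card_eq_fintype_card] at hinj
  apply eq_minpoly_of_monic_of_natDegree_le (Algebra.IsIntegral.isIntegral _)
  · exact (minpoly.monic (Algebra.IsIntegral.isIntegral α)).map _
  · have h := congrArg (FiniteField.frobeniusAlgHom F L : L →+* L) (minpoly.aeval K α)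
    rw [map_zero, aeval_def, hom_eval₂] at h
    rw [conjugatePoly, aeval_def, eval₂_map, ← h]
    congr 1
    ext x
    simp
  · rw [natDegree_minpoly_of_injective hinj, conjugatePoly, natDegree_map]

theorem minpoly_ne_X {α : L} (h0 : α ≠ 0) : minpoly K α ≠ X := by
  intro h
  have := minpoly.aeval K α
  rw [h, aeval_X] at this
  exact h0 this

theorem exists_ne_zero_minpoly_eq (L : Type*) [Field L] [Algebra K L] [IsAlgClosed L] {f : K[X]}
    (hm : f.Monic) (hi : Irreducible f) (hX : f ≠ X) : ∃ α : L, α ≠ 0 ∧ f = minpoly K α := by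
  obtain ⟨α, hα⟩ := IsAlgClosed.exists_aeval_eq_zero L f (degree_pos_of_irreducible hi).ne'
  have e := minpoly.eq_of_irreducible_of_monic hi hα hm
  refine ⟨α, ?_, e⟩
  rintro rfl
  exact hX (by rw [e, minpoly.zero])

end Reciprocal

/-! ### SCRIM and SRIM as a root-of-unity condition -/

section Quadratic

variable {F K L : Type*} [Field F] [Fintype F] [Field K] [Finite K] [Field L]
  [Algebra F L] [Algebra K L] [Algebra.IsAlgebraic K L]

theorem pow_succ_eq_one_iff_inv {α : L} (h0 : α ≠ 0) (k : ℕ) : α ^ (k + 1) = 1 ↔ α ^ k = α⁻¹ := by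
  rw [pow_succ, ← mul_inv_eq_one₀ (inv_ne_zero h0), inv_inv]

/-- Such an `α` is `0` or `±1`. This excludes the degenerate cases below, where it would force
degree 1. -/
theorem pow_card_eq_self_of_inv_eq_self {α : L} (h : α⁻¹ = α) : α ^ Fintype.card F = α := by
  rcases eq_or_ne α 0 with rfl | h0
  · simp
  have h2 : α ^ 2 = 1 := by rw [pow_two]; nth_rw 1 [← h]; exact inv_mul_cancel₀ h0
  have hF := FiniteField.coe_frobeniusAlgHom F L
  rcases eq_or_eq_neg_of_sq_eq_sq α 1 (by rw [h2, one_pow]) with rfl | rfl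
  · simp
  · have := map_neg (FiniteField.frobeniusAlgHom F L) 1
    rwa [map_one, hF] at this

theorem inv_eq_pow_pow_two_mul {G : Type*} [DivisionMonoid G] {α : G} {q i : ℕ}
    (h : α⁻¹ = α ^ q ^ i) : α ^ q ^ (2 * i) = α := by
  rw [two_mul, pow_add, pow_mul, ← h, inv_pow, ← h, inv_inv]

theorem isSCRIM_minpoly_iff [Algebra F K] {α : L} (h0 : α ≠ 0) :
    IsSCRIM F (minpoly K α) ↔ minpoly K α⁻¹ = minpoly K (α ^ Fintype.card F) := by
  have hα : IsIntegral K α := Algebra.IsIntegral.isIntegral α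
  rw [← monicReciprocal_minpoly h0, ← conjugatePoly_minpoly F α]
  exact ⟨fun h => h.reciprocal_eq,
    fun h => ⟨minpoly.monic hα, minpoly.irreducible hα, minpoly_ne_X h0, h⟩⟩

theorem isSRIM_minpoly_iff {α : L} (h0 : α ≠ 0) :
    IsSRIM (minpoly K α) ↔ minpoly K α⁻¹ = minpoly K α := by
  have hα : IsIntegral K α := Algebra.IsIntegral.isIntegral α
  rw [← monicReciprocal_minpoly h0]
  exact ⟨fun h => h.reciprocal_eq,
    fun h => ⟨minpoly.monic hα, minpoly.irreducible hα, minpoly_ne_X h0, h⟩⟩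

theorem isSCRIM_minpoly_iff_pow_eq_one [Algebra F K] (hK : Nat.card K = Fintype.card F ^ 2)
    {α : L} (h0 : α ≠ 0) (hn : Odd (minpoly K α).natDegree) :
    IsSCRIM F (minpoly K α) ↔
      α ^ (Fintype.card F ^ (minpoly K α).natDegree + 1) = 1 := by
  rw [isSCRIM_minpoly_iff h0, pow_succ_eq_one_iff_inv h0]
  have hself := (pow_card_pow_eq_self_iff (K := K) α _).2 dvd_rfl
  have hiff := pow_card_pow_eq_self_iff (K := K) α
  set n := (minpoly K α).natDegree
  constructor
  · intro h
    obtain ⟨i, hi⟩ := exists_eq_pow_card_pow_of_minpoly_eq h.symm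
    rw [hK, ← pow_mul, ← pow_mul, ← pow_succ'] at hi
    have h2 := inv_eq_pow_pow_two_mul hi
    rw [pow_mul, ← hK, hiff] at h2
    obtain ⟨m, hm⟩ := h2
    -- As `2 * i + 1 = n * m` with `m = 2 * j + 1`, the excess over `n` is `2 * n * j`, a multiple
    -- of the period of `α`.
    have hmodd : Odd m := Nat.Odd.of_mul_right (hm ▸ odd_two_mul_add_one i)
    obtain ⟨j, rfl⟩ := hmodd
    rw [hi, hm, show n * (2 * j + 1) = n + 2 * (n * j) by ring, pow_add, pow_mul _ 2, ← hK,
      mul_comm, pow_mul, show n * j = 0 + n * j by ring, pow_pow_add_mul hself]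
    simp
  · obtain ⟨i, hi⟩ := hn
    intro h
    rw [← h, hi, pow_succ', pow_mul, pow_mul, ← hK, minpoly_pow_card_pow]

theorem isSRIM_minpoly_iff_pow_eq_one [Algebra.IsAlgebraic F L] {α : L} {n : ℕ} (hn : 0 < n)
    (h0 : α ≠ 0) (hd : (minpoly F α).natDegree = 2 * n) :
    IsSRIM (minpoly F α) ↔ α ^ (Fintype.card F ^ n + 1) = 1 := by
  rw [isSRIM_minpoly_iff h0, pow_succ_eq_one_iff_inv h0]
  have hiff := pow_card_pow_eq_self_iff (K := F) α
  have hmin := minpoly_pow_card_pow (K := F) α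
  rw [hd, Nat.card_eq_fintype_card] at hiff
  rw [Nat.card_eq_fintype_card] at hmin
  constructor
  · intro h
    obtain ⟨i, hi⟩ := exists_eq_pow_card_pow_of_minpoly_eq h.symm
    rw [Nat.card_eq_fintype_card] at hi
    have h2 := (hiff _).1 (inv_eq_pow_pow_two_mul hi)
    obtain ⟨m, rfl⟩ := Nat.dvd_of_mul_dvd_mul_left two_pos h2
    have hself := (hiff _).2 dvd_rfl
    rw [← Nat.card_eq_fintype_card] at hself
    -- Here `i = n * m` and the period is `2 * n`. Even `m` gives `α⁻¹ = α`, hence degree 1; odd `m`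
    -- reduces `i` to `n`.
    rcases Nat.even_or_odd' m with ⟨j, rfl | rfl⟩
    · have h1 := (hiff (n * (2 * j))).2 ⟨j, by ring⟩
      have h3 := (hiff 1).1 (by rw [pow_one]; exact pow_card_eq_self_of_inv_eq_self (hi.trans h1))
      have := Nat.le_of_dvd one_pos h3
      omega
    · rw [hi, show n * (2 * j + 1) = n + 2 * n * j by ring, ← Nat.card_eq_fintype_card,
        pow_pow_add_mul hself]
  · intro h
    rw [← h, hmin]

theorem natDegree_minpoly_base_of_pow_eq_one [Algebra.IsAlgebraic F L]
    (hK : Nat.card K = Fintype.card F ^ 2) {α : L} (h0 : α ≠ 0)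
    (hn : 1 < (minpoly K α).natDegree)
    (h : α ^ (Fintype.card F ^ (minpoly K α).natDegree + 1) = 1) :
    (minpoly F α).natDegree = 2 * (minpoly K α).natDegree := by
  have hiffK := pow_card_pow_eq_self_iff (K := K) α
  have hiffF := pow_card_pow_eq_self_iff (K := F) α
  rw [Nat.card_eq_fintype_card] at hiffF
  rw [pow_succ_eq_one_iff_inv h0] at h
  set n := (minpoly K α).natDegree
  set m := (minpoly F α).natDegree
  have h1 : m ∣ 2 * n := (hiffF _).1 (inv_eq_pow_pow_two_mul h.symm)
  have h2 : n ∣ m := by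
    rw [← hiffK, hK, ← pow_mul, hiffF]
    exact dvd_mul_left _ _
  obtain ⟨c, hc⟩ := h2
  rw [hc, mul_comm 2 n] at h1
  have hc2 : c ∣ 2 := Nat.dvd_of_mul_dvd_mul_left (by omega) h1
  -- If `c = 1`, then `α⁻¹ = α`, which contradicts `1 < n`.
  rcases (Nat.dvd_prime Nat.prime_two).1 hc2 with rfl | rfl
  · rw [mul_one] at hc
    have e : α⁻¹ = α := by rw [← h, hiffF, hc]
    have h3 := pow_card_eq_self_of_inv_eq_self (F := F) e
    have h4 : n ∣ 1 := by
      rw [← hc, ← hiffF, pow_one, h3]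
    have := Nat.le_of_dvd one_pos h4
    omega
  · rw [hc, mul_comm]

end Quadratic

/-! ### Counting by degree and Möbius inversion -/

theorem natDegree_minpoly_dvd_of_pow_eq_one {K L : Type*} [Field K] [Finite K] [Field L]
    [Algebra K L] [Algebra.IsAlgebraic K L] {q : ℕ} (hK : Nat.card K = q ^ 2) {α : L} {m : ℕ}
    (h : α ^ (q ^ m + 1) = 1) : (minpoly K α).natDegree ∣ m := by
  have h0 : α ≠ 0 := by rintro rfl; simp at h
  rw [pow_succ_eq_one_iff_inv h0] at h
  rw [← pow_card_pow_eq_self_iff, hK, ← pow_mul, inv_eq_pow_pow_two_mul h.symm]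

theorem pow_eq_one_iff_of_natDegree_dvd {K L : Type*} [Field K] [Finite K] [Field L]
    [Algebra K L] [Algebra.IsAlgebraic K L] {q : ℕ} (hK : Nat.card K = q ^ 2) {α : L} {m : ℕ}
    (hm : Odd m) (hd : (minpoly K α).natDegree ∣ m) :
    α ^ (q ^ m + 1) = 1 ↔ α ^ (q ^ (minpoly K α).natDegree + 1) = 1 := by
  have hself := (pow_card_pow_eq_self_iff (K := K) α _).2 dvd_rfl
  set n := (minpoly K α).natDegree
  obtain ⟨c, rfl⟩ := hd
  obtain ⟨j, rfl⟩ := Nat.Odd.of_mul_right hm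
  have : α ^ q ^ (n * (2 * j + 1)) = α ^ q ^ n := by
    rw [show n * (2 * j + 1) = n + 2 * (n * j) by ring, pow_add, pow_mul _ 2, ← hK,
      mul_comm, pow_mul, show n * j = 0 + n * j by ring, pow_pow_add_mul hself]
    simp
  rw [pow_succ, pow_succ, this]

/-- The roots in `L` of the SCRIM polynomials of degree `m` (for odd `m`). -/
noncomputable def scrimRoots (F K L : Type*) [Fintype F] [Field K] [Field L] [Algebra K L]
    (m : ℕ) : Finset L := by
  classical exact
    {α ∈ nthRootsFinset (Fintype.card F ^ m + 1) (1 : L) | (minpoly K α).natDegree = m}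

theorem mem_scrimRoots {F K L : Type*} [Fintype F] [Field K] [Field L] [Algebra K L] {m : ℕ}
    {α : L} :
    α ∈ scrimRoots F K L m ↔
      α ^ (Fintype.card F ^ m + 1) = 1 ∧ (minpoly K α).natDegree = m := by
  simp [scrimRoots, mem_nthRootsFinset (Nat.succ_pos _)]

theorem card_nthRootsFinset_card_pow_add_one (F L : Type*) [Field F] [Fintype F] [Field L]
    [Algebra F L] [IsAlgClosed L] {m : ℕ} (hm : m ≠ 0) :
    (nthRootsFinset (Fintype.card F ^ m + 1) (1 : L)).card = Fintype.card F ^ m + 1 := by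
  have : NeZero ((Fintype.card F ^ m + 1 : ℕ) : L) := by
    constructor
    have h : ((Fintype.card F : ℕ) : L) = 0 := by
      rw [← map_natCast (algebraMap F L), FiniteField.cast_card_eq_zero, map_zero]
    -- `q ^ m + 1` equals `1` in `L`.
    simp [h, hm]
  obtain ⟨ζ, hζ⟩ := HasEnoughRootsOfUnity.exists_primitiveRoot L (Fintype.card F ^ m + 1)
  exact hζ.card_nthRootsFinset

section Counting

variable {F K L : Type*} [Field F] [Fintype F] [Field K] [Finite K] [Field L]
  [Algebra F L] [Algebra K L] [Algebra.IsAlgebraic K L] [IsAlgClosed L]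

theorem sum_card_scrimRoots (hK : Nat.card K = Fintype.card F ^ 2) {m : ℕ} (hm : Odd m) :
    ∑ d ∈ m.divisors, (scrimRoots F K L d).card = Fintype.card F ^ m + 1 := by
  classical
  have hm0 : m ≠ 0 := hm.pos.ne'
  rw [← card_nthRootsFinset_card_pow_add_one F L hm0,
    Finset.card_eq_sum_card_fiberwise (f := fun α : L => (minpoly K α).natDegree)
      (t := m.divisors)]
  · refine Finset.sum_congr rfl fun d hd => ?_
    congr 1
    ext α
    rw [mem_scrimRoots, Finset.mem_filter, mem_nthRootsFinset (Nat.succ_pos _)]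
    refine and_congr_left ?_
    rintro rfl
    exact (pow_eq_one_iff_of_natDegree_dvd hK hm (Nat.dvd_of_mem_divisors hd)).symm
  · intro α hα
    have h := (mem_nthRootsFinset (Nat.succ_pos _) _).1 hα
    exact Finset.mem_coe.2 (Nat.mem_divisors.2 ⟨natDegree_minpoly_dvd_of_pow_eq_one hK h, hm0⟩)

theorem card_scrimRoots (hK : Nat.card K = Fintype.card F ^ 2) {n : ℕ} (hn : Odd n)
    (hn1 : 1 < n) :
    ((scrimRoots F K L n).card : ℚ) =
      ∑ d ∈ n.divisors, (ArithmeticFunction.moebius d : ℚ) * (Fintype.card F : ℚ) ^ (n / d) := by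
  have h := (ArithmeticFunction.sum_eq_iff_sum_mul_moebius_eq_on (R := ℚ)
    (f := fun d => ((scrimRoots F K L d).card : ℚ)) (g := fun m => (Fintype.card F : ℚ) ^ m + 1)
    -- The divisor sum is known only for odd `m`, a set closed under divisors, which suffices for
    -- inversion.
    {m | Odd m} fun m k hmk hk => Odd.of_dvd_nat hk hmk).1
    (fun m _ hm => by exact_mod_cast sum_card_scrimRoots hK hm) n hn.pos hn
  rw [← h, Nat.sum_divisorsAntidiagonal
    (fun a b => (ArithmeticFunction.moebius a : ℚ) * ((Fintype.card F : ℚ) ^ b + 1))]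
  simp only [mul_add, mul_one, Finset.sum_add_distrib]
  -- The `+ 1` contributes nothing because `n > 1`.
  have h0 : ∑ d ∈ n.divisors, ArithmeticFunction.moebius d = 0 := by
    rw [← ArithmeticFunction.coe_mul_zeta_apply, ArithmeticFunction.moebius_mul_coe_zeta,
      ArithmeticFunction.one_apply_ne hn1.ne']
  have h1 : ∑ d ∈ n.divisors, (ArithmeticFunction.moebius d : ℚ) = 0 := by exact_mod_cast h0
  rw [h1, add_zero]

/-- The fibres of `minpoly K` are full root sets of separable polynomials of degree `n`. -/
theorem card_scrimRoots_eq_mul_ncard [Algebra F K] (hK : Nat.card K = Fintype.card F ^ 2) {n : ℕ}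
    (hn : Odd n) :
    (scrimRoots F K L n).card = {f : K[X] | IsSCRIM F f ∧ f.natDegree = n}.ncard * n := by
  classical
  have hset : {f : K[X] | IsSCRIM F f ∧ f.natDegree = n} =
      ((scrimRoots F K L n).image (minpoly K) : Finset K[X]) := by
    ext f
    simp only [Set.mem_ofPred_eq, Finset.coe_image, Set.mem_image, Finset.mem_coe, mem_scrimRoots]
    constructor
    · rintro ⟨hf, rfl⟩
      obtain ⟨α, h0, rfl⟩ := exists_ne_zero_minpoly_eq L hf.monic hf.irreducible hf.ne_X
      exact ⟨α, ⟨(isSCRIM_minpoly_iff_pow_eq_one hK h0 hn).1 hf, rfl⟩, rfl⟩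
    · rintro ⟨α, ⟨h, rfl⟩, rfl⟩
      have h0 : α ≠ 0 := by rintro rfl; simp at h
      exact ⟨(isSCRIM_minpoly_iff_pow_eq_one hK h0 hn).2 h, rfl⟩
  rw [hset, Set.ncard_coe_finset, Finset.card_eq_sum_card_image (minpoly K), Finset.sum_const_nat]
  intro f hf
  obtain ⟨α, hα, rfl⟩ := Finset.mem_image.1 hf
  obtain ⟨h, hd⟩ := mem_scrimRoots.1 hα
  have h0 : α ≠ 0 := by rintro rfl; simp at h
  have hint : IsIntegral K α := Algebra.IsIntegral.isIntegral α
  have hirr := minpoly.irreducible hint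
  have hfib : (scrimRoots F K L n).filter (fun β => minpoly K β = minpoly K α) =
      ((minpoly K α).rootSet L).toFinset := by
    ext β
    rw [Finset.mem_filter, Set.mem_toFinset, mem_rootSet_of_ne hirr.ne_zero]
    constructor
    · rintro ⟨-, e⟩
      rw [← e]
      exact minpoly.aeval K β
    · intro hβ
      have e := minpoly.eq_of_irreducible_of_monic hirr hβ (minpoly.monic hint)
      have hs := (isSCRIM_minpoly_iff_pow_eq_one hK h0 (hd ▸ hn)).2 (hd.symm ▸ h)
      have hβ0 : β ≠ 0 := by
        rintro rfl
        exact minpoly_ne_X h0 (by rw [e, minpoly.zero])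
      rw [e] at hs hd
      refine ⟨mem_scrimRoots.2 ⟨?_, hd⟩, e.symm⟩
      have := (isSCRIM_minpoly_iff_pow_eq_one hK hβ0 (hd ▸ hn)).1 hs
      rwa [hd] at this
  rw [hfib, Set.toFinset_card, card_rootSet_eq_natDegree (PerfectField.separable_of_irreducible hirr)
    (IsAlgClosed.splits _), hd]

end Counting

/-! ### The characterisation and the count -/

theorem corollary1 {F K : Type*} [Field F] [Fintype F] [Field K] [Algebra F K]
    (hFK : Module.finrank F K = 2) (n : ℕ) (hn : Odd n) (hn1 : 1 < n) :
    (∀ f : K[X], f.Monic → Irreducible f → f.natDegree = n →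
      (IsSCRIM F f ↔
        ∃ G : F[X], IsSRIM G ∧ G.natDegree = 2 * n ∧ f ∣ G.map (algebraMap F K))) ∧
    ({f : K[X] | IsSCRIM F f ∧ f.natDegree = n}.ncard : ℚ) =
      1 / (n : ℚ) * ∑ d ∈ n.divisors,
        (ArithmeticFunction.moebius d : ℚ) * (Fintype.card F : ℚ) ^ (n / d) := by
  have hfin : FiniteDimensional F K := Module.finite_of_finrank_pos (by omega)
  have : Finite K := Module.finite_of_finite F
  have hK : Nat.card K = Fintype.card F ^ 2 := by
    rw [Module.natCard_eq_pow_finrank (K := F), hFK, Nat.card_eq_fintype_card]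
  have : Algebra.IsAlgebraic F (AlgebraicClosure K) := Algebra.IsAlgebraic.trans F K _
  constructor
  · rintro f hm hi rfl
    have hX : f ≠ X := by rintro rfl; simp at hn1
    obtain ⟨α, h0, rfl⟩ := exists_ne_zero_minpoly_eq (AlgebraicClosure K) hm hi hX
    rw [isSCRIM_minpoly_iff_pow_eq_one hK h0 hn]
    constructor
    · intro h
      have hd := natDegree_minpoly_base_of_pow_eq_one hK h0 hn1 h
      exact ⟨minpoly F α, (isSRIM_minpoly_iff_pow_eq_one hn.pos h0 hd).2 h, hd,
        minpoly.dvd_map_of_isScalarTower F K α⟩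
    · rintro ⟨G, hG, hd, hdvd⟩
      have hα : aeval α G = 0 := by
        rw [← aeval_map_algebraMap K]
        exact aeval_eq_zero_of_dvd_aeval_eq_zero hdvd (minpoly.aeval K α)
      obtain rfl := minpoly.eq_of_irreducible_of_monic hG.irreducible hα hG.monic
      exact (isSRIM_minpoly_iff_pow_eq_one hn.pos h0 hd).1 hG
  · rw [← card_scrimRoots (L := AlgebraicClosure K) hK hn hn1, card_scrimRoots_eq_mul_ncard hK hn]
    have : (n : ℚ) ≠ 0 := by exact_mod_cast hn.pos.ne'
    push_cast
    field_simp
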